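/- For integers $n\ge 0$ and $u$ put $$T_n^{(u)}=\sum_{k=0}^n\binom{n}{k}^{u}\bigl\{1+u(n-2k)H_k\bigr\},$$ where $H_k=\sum_{j=1}^k \frac1j$ (so $H_0=0$), and let $(x)_0=1$, $(x)_k=x(x+1)\cdots(x+k-1)$ for $k\ge 1$. Then for all integers $n\ge 0$ and $m\ge 0$, with the convention $i_{m+1}=n$, $$T_n^{(-2m)}=(1+n)^{m+1}\sum_{0\le i_1\le i_2\le\cdots\le i_m\le n}\ \prod_{r=1}^{m}\frac{1}{1+n-i_r}\cdot\frac{(1)_{i_r}\,(-i_{r+1})_{i_r}}{(-n)_{i_r}\,(2+n-i_{r+1})_{i_r}}.$$ Moreover, for all $n\ge 0$, $$T_n^{(-4)}=(1+n)^3\sum_{i=0}^n\frac{1}{1+i}\sum_{j=0}^i\frac{(1)_j(-i)_j}{(-n)_j(1+n-i)_{j+1}}\,\frac{1}{1+n-j},$$ $$T_n^{(-6)}=(1+n)^4\sum_{i=0}^n\frac{1}{1+i}\sum_{j=0}^i\frac{(1)_j(-i)_j}{(-n)_j(1+n-i)_{j+1}}\sum_{t=0}^j\frac{(1)_t(-j)_t}{(-n)_t(1+n-j)_{t+1}}\,\frac{1}{1+n-t}.$$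 -/

import Mathlib

open Finset

/-- `T_n^{(u)} = ∑_{k=0}^n binom(n,k)^u (1 + u (n - 2k) H_k)`, with `H_k` the harmonic numbers. -/
def harmonicT (n : ℕ) (u : ℤ) : ℚ :=
  ∑ k ∈ range (n + 1),
    (n.choose k : ℚ) ^ u * (1 + (u : ℚ) * ((n : ℚ) - 2 * (k : ℚ)) * harmonic k)

/-- The shifted factorial `(x)_k = x (x + 1) ⋯ (x + k - 1)`. -/
noncomputable def shiftedFactorial (x : ℚ) (k : ℕ) : ℚ :=
  (ascPochhammer ℚ k).eval x

/-- The finite set of all tuples `0 ≤ i_1 ≤ i_2 ≤ ⋯ ≤ i_m ≤ n`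
(the entry `i_r` has index `r - 1` in `Fin m`). -/
def weakChains (m n : ℕ) : Finset (Fin m → ℕ) :=
  (Fintype.piFinset fun _ : Fin m => range (n + 1)).filter
    fun i => ∀ r s : Fin m, r ≤ s → i r ≤ i s

/-- The tuple `(i_1, …, i_m, i_{m+1})` with `i_{m+1} = n`. -/
def extendChain {m : ℕ} (n : ℕ) (i : Fin m → ℕ) : Fin (m + 1) → ℕ :=
  Fin.snoc (α := fun _ => ℕ) i n

/-!
The nested sums are what the Bailey chain produces, and the harmonic numbers come from a confluence
of its terms at an exceptional value of the parameter.

Consider the operator on sequences in `N` that multiplies by `(N! / (a)_N) ^ 2` and then convolves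
with `(a - 1)_i / i!`. For generic `a`, the sequence `(a)_N ^ 2 / ((N - k)! (a)_{N + k + 1})`,
supported on `N ≥ k`, is an eigenvector with eigenvalue `(k! / (a)_k) ^ 2` (`sum_bailey_kernel`, an
instance of the Pfaff–Saalschütz sum `sum_saalschutz`). Iterating from the unit Bailey pair
(`sum_range_unitBaileyAlpha`) expands the iterated convolution `baileyBeta a m n` as a single
very-well-poised sum (`baileyBeta_eq_sum`).

The iterated convolution is regular at `a = -n`, whereas in the single sum the terms `k` and `n - k`
acquire opposite simple poles there. Multiplying by `a + n` makes every term regular, and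
the limit `a → -n` becomes a derivative: `baileyBeta (-n) m n` is the sum of the derivatives at `-n`
of the regularised terms. Their logarithmic derivatives consist of harmonic numbers, and the
symmetry `k ↦ n - k` reduces these to `H_k`, which gives `(-1) ^ n * harmonicT n (-2 * m)`
(`baileyBeta_neg_self`).

On the other hand, at `a = -n` the recursion for `baileyBeta` is, up to normalisation, the recursion
that splits off the largest entry of a chain (`baileyBeta_neg`, `chainSum_succ`). The double and
triple sums are the cases `m = 2` and `m = 3`, where the step from the largest entry `i` to `n` has
weight `1 / ((1 + i) (1 + n - i))`.
-/

/-! ### Shifted factorials -/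

lemma shiftedFactorial_zero (x : ℚ) : shiftedFactorial x 0 = 1 := by
  simp [shiftedFactorial]

lemma shiftedFactorial_succ (x : ℚ) (k : ℕ) :
    shiftedFactorial x (k + 1) = shiftedFactorial x k * (x + k) := by
  simp [shiftedFactorial, ascPochhammer_succ_eval]

lemma shiftedFactorial_one (x : ℚ) : shiftedFactorial x 1 = x := by
  simp [shiftedFactorial]

lemma shiftedFactorial_add (x : ℚ) (j k : ℕ) :
    shiftedFactorial x (j + k) = shiftedFactorial x j * shiftedFactorial (x + j) k := by
  induction k with
  | zero => simp [shiftedFactorial_zero]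
  | succ k ih =>
    rw [← add_assoc, shiftedFactorial_succ, shiftedFactorial_succ, ih]
    push_cast
    ring

lemma shiftedFactorial_succ_left (x : ℚ) (k : ℕ) :
    shiftedFactorial x (k + 1) = x * shiftedFactorial (x + 1) k := by
  rw [add_comm, shiftedFactorial_add, shiftedFactorial_one]
  simp

lemma shiftedFactorial_one_left (k : ℕ) : shiftedFactorial 1 k = (k.factorial : ℚ) := by
  simp [shiftedFactorial]

lemma shiftedFactorial_ne_zero {x : ℚ} {k : ℕ} (h : ∀ i < k, x + (i : ℕ) ≠ 0) :
    shiftedFactorial x k ≠ 0 := by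
  induction k with
  | zero => simp [shiftedFactorial_zero]
  | succ k ih =>
    rw [shiftedFactorial_succ]
    exact mul_ne_zero (ih fun i hi => h i (by omega)) (h k (by omega))

lemma shiftedFactorial_neg_ne_zero {n k : ℕ} (h : k ≤ n) :
    shiftedFactorial (-(n : ℚ)) k ≠ 0 := by
  refine shiftedFactorial_ne_zero fun i hi h0 => ?_
  have : (i : ℚ) = n := by linarith
  have : i = n := by exact_mod_cast this
  omega

lemma shiftedFactorial_pos {x : ℚ} (hx : 0 < x) (k : ℕ) : 0 < shiftedFactorial x k :=
  ascPochhammer_pos k x hx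

lemma shiftedFactorial_neg_mul_factorial {n k : ℕ} (h : k ≤ n) :
    shiftedFactorial (-(n : ℚ)) k * ((n - k).factorial : ℚ) = (-1) ^ k * (n.factorial : ℚ) := by
  induction k with
  | zero => simp [shiftedFactorial_zero]
  | succ k ih =>
    have ih := ih (by omega)
    have e : n - k = (n - (k + 1)) + 1 := by omega
    have hc : ((n - (k + 1) : ℕ) : ℚ) = n - k - 1 := by
      rw [Nat.cast_sub h]; push_cast; ring
    rw [e, Nat.factorial_succ] at ih
    push_cast at ih
    rw [hc] at ih
    rw [shiftedFactorial_succ, pow_succ]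
    linear_combination -ih

/-- Reversing the last `j` factors of `(x)_N`. -/
lemma shiftedFactorial_reflect (x : ℚ) {N j : ℕ} (h : j ≤ N) :
    shiftedFactorial x N =
      (-1) ^ j * shiftedFactorial x (N - j) * shiftedFactorial (1 - x - N) j := by
  induction j with
  | zero => simp [shiftedFactorial_zero]
  | succ j ih =>
    have ih := ih (by omega)
    have e : N - j = (N - (j + 1)) + 1 := by omega
    have hc : ((N - (j + 1) : ℕ) : ℚ) = N - j - 1 := by
      rw [Nat.cast_sub h]; push_cast; ring
    rw [e, shiftedFactorial_succ, hc] at ih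
    rw [ih, shiftedFactorial_succ, pow_succ]
    ring

/-! ### The Pfaff–Saalschütz sum -/

/-- Cleared of denominators, the terms `t M i` of the Pfaff–Saalschütz sum satisfy
`t (M + 1) i - (c - x + M) * (c - y + M) * t M i = g (i - 1) - g i` for the `g` displayed on the
right; this is the resulting partial sum. -/
lemma sum_range_saalschutz_telescope (x y c : ℚ) (M s : ℕ) (hs : s ≤ M) :
    ∑ i ∈ range (s + 1),
      (((M + 1).choose i : ℚ) * shiftedFactorial (c - x - y) (M + 1 - i) *
          shiftedFactorial x i * shiftedFactorial y i * shiftedFactorial (c + i) (M + 1 - i) -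
        (c - x + M) * (c - y + M) *
          ((M.choose i : ℚ) * shiftedFactorial (c - x - y) (M - i) *
            shiftedFactorial x i * shiftedFactorial y i * shiftedFactorial (c + i) (M - i))) =
      -((M.choose s : ℚ) * shiftedFactorial x (s + 1) * shiftedFactorial y (s + 1) *
        shiftedFactorial (c - x - y) (M - s) * shiftedFactorial (c + s) (M - s)) := by
  induction s with
  | zero =>
    simp [shiftedFactorial_zero, shiftedFactorial_succ]
    ring
  | succ s ih =>
    rw [sum_range_succ, ih (by omega)]
    obtain ⟨d, rfl⟩ : ∃ d, M = s + 1 + d := ⟨M - (s + 1), by omega⟩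
    have e1 : s + 1 + d - s = d + 1 := by omega
    have e2 : s + 1 + d + 1 - (s + 1) = d + 1 := by omega
    have e3 : s + 1 + d - (s + 1) = d := by omega
    have hch : ((s + 1 + d).choose (s + 1) : ℚ) * (s + 1) = (s + 1 + d).choose s * (d + 1) := by
      have := Nat.choose_succ_right_eq (s + 1 + d) s
      rw [e1] at this
      exact_mod_cast this
    rw [e1, e2, e3, Nat.choose_succ_succ' (s + 1 + d) s, shiftedFactorial_succ x (s + 1),
      shiftedFactorial_succ y (s + 1), shiftedFactorial_succ (c - x - y),
      shiftedFactorial_succ_left (c + s), shiftedFactorial_succ (c + (s + 1 : ℕ))]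
    push_cast
    rw [show c + (s : ℚ) + 1 = c + (s + 1) by ring]
    -- the common factors of all terms; the remaining polynomial identity needs only the ratio `hch`
    -- of consecutive binomial coefficients
    linear_combination (-(shiftedFactorial x (s + 1) * shiftedFactorial y (s + 1) *
      shiftedFactorial (c - x - y) d * shiftedFactorial (c + (s + 1)) d * (c - x - y + d))) * hch

/-- The Pfaff–Saalschütz sum, cleared of denominators. -/
lemma sum_choose_mul_shiftedFactorial_saalschutz (x y c : ℚ) (M : ℕ) :
    ∑ i ∈ range (M + 1), (M.choose i : ℚ) * shiftedFactorial (c - x - y) (M - i) *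
        shiftedFactorial x i * shiftedFactorial y i * shiftedFactorial (c + i) (M - i) =
      shiftedFactorial (c - x) M * shiftedFactorial (c - y) M := by
  induction M with
  | zero => simp [shiftedFactorial_zero]
  | succ M ih =>
    have h := sum_range_saalschutz_telescope x y c M M le_rfl
    rw [sum_sub_distrib, ← mul_sum, ih] at h
    rw [sum_range_succ, sub_eq_iff_eq_add.mp h, shiftedFactorial_succ (c - x),
      shiftedFactorial_succ (c - y)]
    simp [shiftedFactorial_zero]
    ring

/-- The Pfaff–Saalschütz sum, written as a convolution. -/
lemma sum_saalschutz (x y c : ℚ) (M : ℕ) (hc : shiftedFactorial c M ≠ 0) :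
    ∑ i ∈ range (M + 1), shiftedFactorial (c - x - y) (M - i) / ((M - i).factorial : ℚ) *
        (shiftedFactorial x i * shiftedFactorial y i /
          ((i.factorial : ℚ) * shiftedFactorial c i)) =
      shiftedFactorial (c - x) M * shiftedFactorial (c - y) M /
        ((M.factorial : ℚ) * shiftedFactorial c M) := by
  have hM : (M.factorial : ℚ) ≠ 0 := by exact_mod_cast M.factorial_ne_zero
  rw [← sum_choose_mul_shiftedFactorial_saalschutz, sum_div]
  refine sum_congr rfl fun i hi => ?_
  have hi : i ≤ M := by simpa [Nat.lt_succ_iff] using hi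
  have hsplit := shiftedFactorial_add c i (M - i)
  rw [Nat.add_sub_cancel' hi] at hsplit
  have hci : shiftedFactorial c i ≠ 0 := fun h => hc (by rw [hsplit, h, zero_mul])
  have hci' : shiftedFactorial (c + i) (M - i) ≠ 0 := fun h => hc (by rw [hsplit, h, mul_zero])
  have h1 : (i.factorial : ℚ) ≠ 0 := by exact_mod_cast i.factorial_ne_zero
  have h2 : ((M - i).factorial : ℚ) ≠ 0 := by exact_mod_cast (M - i).factorial_ne_zero
  rw [Nat.cast_choose ℚ hi, hsplit]
  field_simp

/-! ### The Bailey chain -/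

/-- The Bailey lemma with both free parameters equal to `1`, for one column `k` of the lower
triangular kernel `1 / ((j - k)! (a)_{j + k + 1})`. -/
lemma sum_bailey_kernel (a : ℚ) (ha : ∀ i : ℕ, a + i ≠ 0) (N k : ℕ) (hk : k ≤ N) :
    ∑ j ∈ Ico k (N + 1), shiftedFactorial (a - 1) (N - j) / ((N - j).factorial : ℚ) *
        ((j.factorial : ℚ) ^ 2 / (((j - k).factorial : ℚ) * shiftedFactorial a (j + k + 1))) =
      shiftedFactorial a N ^ 2 * ((k.factorial : ℚ) / shiftedFactorial a k) ^ 2 /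
        (((N - k).factorial : ℚ) * shiftedFactorial a (N + k + 1)) := by
  obtain ⟨M, rfl⟩ : ∃ M, N = k + M := ⟨N - k, by omega⟩
  have hc : ∀ i, shiftedFactorial (a + (2 * k + 1 : ℕ)) i ≠ 0 := fun i =>
    shiftedFactorial_ne_zero fun t _ => by
      have := ha (2 * k + 1 + t)
      push_cast at this ⊢
      rwa [add_assoc]
  have hne : ∀ i, shiftedFactorial a i ≠ 0 := fun i => shiftedFactorial_ne_zero fun t _ => ha t
  -- after the shift `j = k + i`
  have hS := sum_saalschutz (k + 1) (k + 1) (a + (2 * k + 1 : ℕ)) M (hc M)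
  have e1 : a + ((2 * k + 1 : ℕ) : ℚ) - (k + 1) - (k + 1) = a - 1 := by push_cast; ring
  have e2 : a + ((2 * k + 1 : ℕ) : ℚ) - (k + 1) = a + k := by push_cast; ring
  rw [e1, e2] at hS
  have hfac : ∀ i : ℕ, ((k + i).factorial : ℚ) =
      k.factorial * shiftedFactorial (k + 1) i := fun i => by
    rw [← shiftedFactorial_one_left, shiftedFactorial_add, shiftedFactorial_one_left, add_comm 1]
  have hk0 : (k.factorial : ℚ) ≠ 0 := by exact_mod_cast k.factorial_ne_zero
  have hsplit : ∀ i : ℕ, shiftedFactorial a (k + i + k + 1) =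
      shiftedFactorial a (2 * k + 1) * shiftedFactorial (a + (2 * k + 1 : ℕ)) i := fun i => by
    rw [← shiftedFactorial_add]; congr 1; ring
  rw [sum_Ico_eq_sum_range, show k + M + 1 - k = M + 1 by omega, hsplit, shiftedFactorial_add a k M,
    show k + M - k = M by omega]
  trans ((k.factorial : ℚ) ^ 2 / shiftedFactorial a (2 * k + 1)) *
      (shiftedFactorial (a + k) M * shiftedFactorial (a + k) M /
        ((M.factorial : ℚ) * shiftedFactorial (a + (2 * k + 1 : ℕ)) M))
  · rw [← hS, mul_sum]
    refine sum_congr rfl fun i _ => ?_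
    rw [hsplit, hfac, show k + M - (k + i) = M - i by omega, show k + i - k = i by omega]
    have := hc i
    have := hne (2 * k + 1)
    have : (i.factorial : ℚ) ≠ 0 := by exact_mod_cast i.factorial_ne_zero
    have : ((M - i).factorial : ℚ) ≠ 0 := by exact_mod_cast (M - i).factorial_ne_zero
    field_simp
  · have := hc M
    have := hne (2 * k + 1)
    have := hne k
    have : (M.factorial : ℚ) ≠ 0 := by exact_mod_cast M.factorial_ne_zero
    field_simp

/-- The Bailey lemma with both free parameters equal to `1`, for an arbitrary sequence `α`. -/
lemma sum_bailey_step (a : ℚ) (ha : ∀ i : ℕ, a + i ≠ 0) (α : ℕ → ℚ) (N : ℕ) :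
    ∑ j ∈ range (N + 1), shiftedFactorial (a - 1) (N - j) / ((N - j).factorial : ℚ) *
        (j.factorial : ℚ) ^ 2 *
        ∑ k ∈ range (j + 1),
          α k / (((j - k).factorial : ℚ) * shiftedFactorial a (j + k + 1)) =
      shiftedFactorial a N ^ 2 *
        ∑ k ∈ range (N + 1), ((k.factorial : ℚ) / shiftedFactorial a k) ^ 2 * α k /
          (((N - k).factorial : ℚ) * shiftedFactorial a (N + k + 1)) := by
  simp_rw [mul_sum]
  rw [sum_comm' (t' := range (N + 1)) (s' := fun k => Ico k (N + 1))
    (by intro x y; simp only [mem_range, mem_Ico]; omega)]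
  refine sum_congr rfl fun k hk => ?_
  have hk : k ≤ N := by simpa [Nat.lt_succ_iff] using hk
  trans α k * (shiftedFactorial a N ^ 2 * ((k.factorial : ℚ) / shiftedFactorial a k) ^ 2 /
        (((N - k).factorial : ℚ) * shiftedFactorial a (N + k + 1)))
  · rw [← sum_bailey_kernel a ha N k hk, mul_sum]
    exact sum_congr rfl fun j _ => by ring
  · ring

/-- The `α`-part of the unit Bailey pair, times `a`. The extra factor turns the usual kernel
`1 / ((N - k)! (a + 1)_{N + k})` into `1 / ((N - k)! (a)_{N + k + 1})`. -/
noncomputable def unitBaileyAlpha (a : ℚ) (k : ℕ) : ℚ :=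
  (-1) ^ k * shiftedFactorial a k * (a + 2 * k) / (k.factorial : ℚ)

lemma sum_range_unitBaileyAlpha_partial (a : ℚ) (ha : ∀ i : ℕ, a + i ≠ 0) (N s : ℕ) (hs : s ≤ N) :
    ∑ k ∈ range (s + 1), unitBaileyAlpha a k /
        (((N + 1 - k).factorial : ℚ) * shiftedFactorial a (N + 1 + k + 1)) =
      (-1) ^ s * shiftedFactorial a (s + 1) /
        ((s.factorial : ℚ) * ((N - s).factorial : ℚ) * (N + 1) *
          shiftedFactorial a (N + 1 + s + 1)) := by
  have hne : ∀ i, shiftedFactorial a i ≠ 0 := fun i => shiftedFactorial_ne_zero fun t _ => ha t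
  have hN : (N : ℚ) + 1 ≠ 0 := by positivity
  induction s with
  | zero =>
    have := hne (N + 1 + 1)
    have : (N.factorial : ℚ) ≠ 0 := by exact_mod_cast N.factorial_ne_zero
    simp [unitBaileyAlpha, shiftedFactorial_zero, shiftedFactorial_one, Nat.factorial_succ]
    field_simp
  | succ s ih =>
    rw [sum_range_succ, ih (by omega)]
    obtain ⟨d, rfl⟩ : ∃ d, N = s + 1 + d := ⟨N - (s + 1), by omega⟩
    have e1 : s + 1 + d - s = d + 1 := by omega
    have e2 : s + 1 + d + 1 - (s + 1) = d + 1 := by omega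
    have e3 : s + 1 + d - (s + 1) = d := by omega
    have e4 : s + 1 + d + 1 + (s + 1) + 1 = s + 1 + d + 1 + s + 1 + 1 := by omega
    rw [e1, e2, e3, e4, shiftedFactorial_succ a (s + 1 + d + 1 + s + 1), unitBaileyAlpha,
      Nat.factorial_succ, Nat.factorial_succ, shiftedFactorial_succ a (s + 1)]
    have h1 := hne (s + 1 + d + 1 + s + 1)
    have h2 := ha (s + 1 + d + 1 + s + 1)
    have h3 : (s.factorial : ℚ) ≠ 0 := by exact_mod_cast s.factorial_ne_zero
    have h4 : (d.factorial : ℚ) ≠ 0 := by exact_mod_cast d.factorial_ne_zero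
    have h5 : (s : ℚ) + 1 ≠ 0 := by positivity
    have h6 : (d : ℚ) + 1 ≠ 0 := by positivity
    push_cast at h2 hN ⊢
    field_simp
    ring

/-- The unit Bailey pair. -/
lemma sum_range_unitBaileyAlpha (a : ℚ) (ha : ∀ i : ℕ, a + i ≠ 0) (N : ℕ) :
    ∑ k ∈ range (N + 1), unitBaileyAlpha a k /
        (((N - k).factorial : ℚ) * shiftedFactorial a (N + k + 1)) = if N = 0 then 1 else 0 := by
  cases N with
  | zero =>
    have := ha 0
    simp at this
    simp [unitBaileyAlpha, shiftedFactorial_zero, shiftedFactorial_one, this]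
  | succ N =>
    rw [sum_range_succ, sum_range_unitBaileyAlpha_partial a ha N N le_rfl, if_neg (by omega)]
    have hne : ∀ i, shiftedFactorial a i ≠ 0 := fun i => shiftedFactorial_ne_zero fun t _ => ha t
    have h1 := hne (N + 1 + N + 1)
    have h2 := ha (N + 1 + N + 1)
    have h3 : (N.factorial : ℚ) ≠ 0 := by exact_mod_cast N.factorial_ne_zero
    have h5 : (N : ℚ) + 1 ≠ 0 := by positivity
    rw [show N + 1 + (N + 1) + 1 = N + 1 + N + 1 + 1 by ring,
      shiftedFactorial_succ a (N + 1 + N + 1), unitBaileyAlpha, Nat.factorial_succ]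
    push_cast at h2 ⊢
    simp
    field_simp
    ring

/-- `baileyBeta a m N` is `(a)_N ^ 2` times the `β`-part of the Bailey pair obtained from the unit
pair by `m + 1` steps of the Bailey chain, all free parameters being `1`. -/
noncomputable def baileyBeta (a : ℚ) : ℕ → ℕ → ℚ
  | 0, N => shiftedFactorial (a - 1) N / (N.factorial : ℚ)
  | m + 1, N => ∑ j ∈ range (N + 1), shiftedFactorial (a - 1) (N - j) / ((N - j).factorial : ℚ) *
      ((j.factorial : ℚ) / shiftedFactorial a j) ^ 2 * baileyBeta a m j

/-- The expansion of `baileyBeta` in the `α`-part of its Bailey pair, valid for generic `a`. -/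
lemma baileyBeta_eq_sum (a : ℚ) (ha : ∀ i : ℕ, a + i ≠ 0) (m N : ℕ) :
    baileyBeta a m N = shiftedFactorial a N ^ 2 *
      ∑ k ∈ range (N + 1),
        ((k.factorial : ℚ) / shiftedFactorial a k) ^ (2 * m + 2) * unitBaileyAlpha a k /
          (((N - k).factorial : ℚ) * shiftedFactorial a (N + k + 1)) := by
  induction m generalizing N with
  | zero =>
    rw [mul_zero, zero_add, ← sum_bailey_step a ha]
    simp_rw [sum_range_unitBaileyAlpha a ha]
    simp [baileyBeta]
  | succ m ih =>
    have hne : ∀ i, shiftedFactorial a i ≠ 0 := fun i => shiftedFactorial_ne_zero fun t _ => ha t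
    have h := sum_bailey_step a ha (fun k =>
      ((k.factorial : ℚ) / shiftedFactorial a k) ^ (2 * m + 2) * unitBaileyAlpha a k) N
    simp only [← mul_assoc, ← pow_add] at h
    rw [show 2 * (m + 1) + 2 = 2 + (2 * m + 2) by ring, ← h, baileyBeta]
    refine sum_congr rfl fun j _ => ?_
    rw [ih]
    have := hne j
    field_simp

/-! ### Degeneration at `a = -n` -/

lemma continuous_shiftedFactorial (k : ℕ) : Continuous fun a : ℚ => shiftedFactorial a k :=
  (ascPochhammer ℚ k).continuous

lemma continuousAt_baileyBeta (n m N : ℕ) (hN : N ≤ n) :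
    ContinuousAt (fun a : ℚ => baileyBeta a m N) (-(n : ℚ)) := by
  have hsub : ∀ k, ContinuousAt (fun a : ℚ => shiftedFactorial (a - 1) k) (-(n : ℚ)) := fun k =>
    ((continuous_shiftedFactorial k).comp (continuous_id.sub continuous_const)).continuousAt
  induction m generalizing N with
  | zero =>
    simp only [baileyBeta]
    exact (hsub N).div_const _
  | succ m ih =>
    simp only [baileyBeta]
    refine tendsto_finsetSum _ fun j hj => ?_
    have hj : j ≤ N := by simpa [Nat.lt_succ_iff] using hj
    exact (((hsub _).div_const _).mul ((continuousAt_const.div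
      (continuous_shiftedFactorial j).continuousAt
      (shiftedFactorial_neg_ne_zero (hj.trans hN))).pow 2)).mul (ih j (hj.trans hN))

/-- The `k`-th term in the expansion of `(a + n) * baileyBeta a m n`; it is regular at `a = -n`. -/
noncomputable def degenerateTerm (n m k : ℕ) (a : ℚ) : ℚ :=
  (-1) ^ k * (k.factorial : ℚ) ^ (2 * m + 1) / ((n - k).factorial : ℚ) *
    ((shiftedFactorial a n * (shiftedFactorial a k)⁻¹ ^ (2 * m + 1) *
      (shiftedFactorial (a + n + 1) k)⁻¹) * (a + 2 * k))

lemma add_mul_baileyBeta (n m : ℕ) (a : ℚ) (ha : ∀ i : ℕ, a + i ≠ 0) :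
    (a + n) * baileyBeta a m n = ∑ k ∈ range (n + 1), degenerateTerm n m k a := by
  have hne : ∀ i, shiftedFactorial a i ≠ 0 := fun i => shiftedFactorial_ne_zero fun t _ => ha t
  rw [baileyBeta_eq_sum a ha, ← mul_assoc, mul_sum]
  refine sum_congr rfl fun k _ => ?_
  have hsplit : shiftedFactorial a (n + k + 1) =
      shiftedFactorial a n * ((a + n) * shiftedFactorial (a + n + 1) k) := by
    rw [add_assoc, shiftedFactorial_add, shiftedFactorial_succ_left]
  have h0 := hne (n + k + 1)
  rw [hsplit] at h0 ⊢
  obtain ⟨h1, h2, h3⟩ : shiftedFactorial a n ≠ 0 ∧ a + n ≠ 0 ∧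
      shiftedFactorial (a + n + 1) k ≠ 0 := by
    simpa [mul_ne_zero_iff] using h0
  have h4 := hne k
  have h5 : (k.factorial : ℚ) ≠ 0 := by exact_mod_cast k.factorial_ne_zero
  have h6 : ((n - k).factorial : ℚ) ≠ 0 := by exact_mod_cast (n - k).factorial_ne_zero
  rw [unitBaileyAlpha, degenerateTerm, div_pow, inv_pow, pow_succ _ (2 * m + 1),
    pow_succ (shiftedFactorial a k) (2 * m + 1)]
  field_simp

/-- Logarithmic derivatives add up under multiplication, also where the functions vanish. -/
lemma HasDerivAt.mul_of_logDeriv {f g : ℚ → ℚ} {x l l' : ℚ} (hf : HasDerivAt f (f x * l) x)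
    (hg : HasDerivAt g (g x * l') x) :
    HasDerivAt (fun y => f y * g y) (f x * g x * (l + l')) x :=
  (hf.fun_mul hg).congr_deriv (by ring)

lemma HasDerivAt.inv_pow_of_logDeriv {f : ℚ → ℚ} {x l : ℚ} (hf : HasDerivAt f (f x * l) x)
    (hx : f x ≠ 0) (p : ℕ) :
    HasDerivAt (fun y => (f y)⁻¹ ^ p) ((f x)⁻¹ ^ p * -(p * l)) x := by
  refine ((hf.fun_inv hx).fun_pow p).congr_deriv ?_
  cases p with
  | zero => simp
  | succ p =>
    simp only [Nat.add_sub_cancel, pow_succ]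
    field_simp

lemma hasDerivAt_shiftedFactorial_neg (n k : ℕ) (hk : k ≤ n) :
    HasDerivAt (fun a : ℚ => shiftedFactorial a k)
      (shiftedFactorial (-(n : ℚ)) k * (harmonic (n - k) - harmonic n)) (-(n : ℚ)) := by
  induction k with
  | zero => simpa [shiftedFactorial_zero] using hasDerivAt_const (-(n : ℚ)) (1 : ℚ)
  | succ k ih =>
    have e : n - k = (n - (k + 1)) + 1 := by omega
    have hc : ((n - (k + 1) : ℕ) : ℚ) + 1 = n - k := by
      rw [Nat.cast_sub hk]; push_cast; ring
    have hkn : (k : ℚ) < n := by exact_mod_cast hk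
    have h0 : (n : ℚ) - k ≠ 0 := by linarith
    have h0' : -(n : ℚ) + k ≠ 0 := by linarith
    have hlin : HasDerivAt (fun a : ℚ => a + k) ((-(n : ℚ) + k) * (-(n : ℚ) + k)⁻¹) (-(n : ℚ)) := by
      rw [mul_inv_cancel₀ h0']
      exact (hasDerivAt_id _).add_const _
    have h := (ih (by omega)).mul_of_logDeriv hlin
    simp_rw [shiftedFactorial_succ]
    refine h.congr_deriv ?_
    rw [e, harmonic_succ]
    push_cast
    rw [hc, show -(n : ℚ) + k = -(n - k) by ring, inv_neg]
    ring

lemma hasDerivAt_shiftedFactorial_add (n k : ℕ) :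
    HasDerivAt (fun a : ℚ => shiftedFactorial (a + n + 1) k)
      (shiftedFactorial (-(n : ℚ) + n + 1) k * harmonic k) (-(n : ℚ)) := by
  induction k with
  | zero => simpa [shiftedFactorial_zero] using hasDerivAt_const (-(n : ℚ)) (1 : ℚ)
  | succ k ih =>
    have h0 : (k : ℚ) + 1 ≠ 0 := by positivity
    have hlin : HasDerivAt (fun a : ℚ => a + n + 1 + k)
        ((-(n : ℚ) + n + 1 + k) * ((k : ℚ) + 1)⁻¹) (-(n : ℚ)) := by
      rw [show -(n : ℚ) + n + 1 + k = k + 1 by ring, mul_inv_cancel₀ h0]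
      exact (((hasDerivAt_id _).add_const _).add_const _).add_const _
    simp_rw [shiftedFactorial_succ]
    refine (ih.mul_of_logDeriv hlin).congr_deriv ?_
    rw [harmonic_succ]
    push_cast
    ring

lemma hasDerivAt_degenerateTerm (n m k : ℕ) (hk : k ≤ n) :
    HasDerivAt (degenerateTerm n m k)
      ((-1) ^ n * ((n.choose k : ℚ) ^ (-2 * (m : ℤ)) *
        (1 + (2 * k - n) * (2 * m * harmonic n - (2 * m + 1) * harmonic (n - k) - harmonic k))))
      (-(n : ℚ)) := by
  have hnk := shiftedFactorial_neg_ne_zero hk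
  have h1 := (hasDerivAt_shiftedFactorial_neg n n le_rfl).mul_of_logDeriv
    ((hasDerivAt_shiftedFactorial_neg n k hk).inv_pow_of_logDeriv hnk (2 * m + 1))
  have hone : shiftedFactorial (-(n : ℚ) + n + 1) k = (k.factorial : ℚ) := by
    rw [neg_add_cancel, zero_add, shiftedFactorial_one_left]
  have hk0 : (k.factorial : ℚ) ≠ 0 := by exact_mod_cast k.factorial_ne_zero
  have h2 := h1.mul_of_logDeriv ((hasDerivAt_shiftedFactorial_add n k).inv_pow_of_logDeriv
    (by rw [hone]; exact hk0) 1)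
  simp only [pow_one] at h2
  have h3 := (h2.fun_mul ((hasDerivAt_id (-(n : ℚ))).add_const (2 * (k : ℚ)))).const_mul
    ((-1) ^ k * (k.factorial : ℚ) ^ (2 * m + 1) / ((n - k).factorial : ℚ))
  refine HasDerivAt.congr_deriv h3 ?_
  have hn := shiftedFactorial_neg_mul_factorial (le_refl n)
  have hk' := shiftedFactorial_neg_mul_factorial hk
  simp only [Nat.sub_self, Nat.factorial_zero, Nat.cast_one, mul_one] at hn
  have hd0 : ((n - k).factorial : ℚ) ≠ 0 := by exact_mod_cast (n - k).factorial_ne_zero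
  have hn0 : (n.factorial : ℚ) ≠ 0 := by exact_mod_cast n.factorial_ne_zero
  rw [← eq_div_iff hd0] at hk'
  have hs : ((-1 : ℚ) ^ k) ≠ 0 := by simp
  have hs2 : ((-1 : ℚ) ^ k) ^ (2 * m + 1) = (-1) ^ k := by
    rw [← pow_mul, mul_comm, pow_mul, pow_succ, pow_mul]; simp
  -- the value at `-n` of everything but the factor `a + 2 k`
  have hval : (-1) ^ k * (k.factorial : ℚ) ^ (2 * m + 1) / ((n - k).factorial : ℚ) *
      (shiftedFactorial (-(n : ℚ)) n * (shiftedFactorial (-(n : ℚ)) k)⁻¹ ^ (2 * m + 1) *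
        (shiftedFactorial (-(n : ℚ) + n + 1) k)⁻¹) =
      (-1) ^ n * (n.choose k : ℚ) ^ (-2 * (m : ℤ)) := by
    rw [hn, hk', hone, Nat.cast_choose ℚ hk, show -2 * (m : ℤ) = -((2 * m : ℕ) : ℤ) by
      push_cast; ring, zpow_neg, zpow_natCast, inv_pow, div_pow, mul_pow, hs2, div_pow, mul_pow,
      pow_succ, pow_succ, pow_succ]
    field_simp
  rw [← mul_assoc ((-1 : ℚ) ^ n), ← hval]
  simp only [Nat.sub_self, harmonic_zero, id]
  push_cast
  ring

lemma sum_choose_zpow_reflect (n : ℕ) (u : ℤ) (f : ℕ → ℚ) :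
    ∑ k ∈ range (n + 1), (n.choose k : ℚ) ^ u * ((2 * k - n) * f (n - k)) =
      -∑ k ∈ range (n + 1), (n.choose k : ℚ) ^ u * ((2 * k - n) * f k) := by
  rw [← sum_range_reflect, ← sum_neg_distrib]
  refine sum_congr rfl fun k hk => ?_
  have hk : k ≤ n := by simpa [Nat.lt_succ_iff] using hk
  rw [show n + 1 - 1 - k = n - k by omega, Nat.choose_symm hk, Nat.sub_sub_self hk,
    Nat.cast_sub hk]
  ring

/-- Summed over `k`, the derivatives lose their `H_n`, and `H_{n - k}` may be replaced by `-H_k`,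
because `2 k - n` is odd under `k ↦ n - k`. -/
lemma sum_deriv_degenerateTerm (n m : ℕ) :
    ∑ k ∈ range (n + 1), (n.choose k : ℚ) ^ (-2 * (m : ℤ)) *
        (1 + (2 * k - n) *
          (2 * m * harmonic n - (2 * m + 1) * harmonic (n - k) - harmonic k)) =
      harmonicT n (-2 * (m : ℤ)) := by
  have h1 := sum_choose_zpow_reflect n (-2 * (m : ℤ)) fun _ => harmonic n
  have h2 := sum_choose_zpow_reflect n (-2 * (m : ℤ)) harmonic
  have h1 : ∑ k ∈ range (n + 1), (n.choose k : ℚ) ^ (-2 * (m : ℤ)) *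
      ((2 * k - n) * harmonic n) = 0 := by linarith
  have e : ∀ k : ℕ, (n.choose k : ℚ) ^ (-2 * (m : ℤ)) *
        (1 + (2 * k - n) *
          (2 * m * harmonic n - (2 * m + 1) * harmonic (n - k) - harmonic k)) =
      (n.choose k : ℚ) ^ (-2 * (m : ℤ)) +
      2 * m * ((n.choose k : ℚ) ^ (-2 * (m : ℤ)) * ((2 * k - n) * harmonic n)) -
      (2 * m + 1) * ((n.choose k : ℚ) ^ (-2 * (m : ℤ)) * ((2 * k - n) * harmonic (n - k))) -
      (n.choose k : ℚ) ^ (-2 * (m : ℤ)) * ((2 * k - n) * harmonic k) := fun k => by ring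
  have e' : ∀ k : ℕ, (n.choose k : ℚ) ^ (-2 * (m : ℤ)) *
        (1 + ((-2 * (m : ℤ) : ℤ) : ℚ) * ((n : ℚ) - 2 * (k : ℚ)) * harmonic k) =
      (n.choose k : ℚ) ^ (-2 * (m : ℤ)) +
      2 * m * ((n.choose k : ℚ) ^ (-2 * (m : ℤ)) * ((2 * k - n) * harmonic k)) := fun k => by
    push_cast; ring
  rw [harmonicT]
  simp_rw [e, e']
  simp only [sum_sub_distrib, sum_add_distrib, ← mul_sum]
  rw [h1, h2]
  ring

/-- Both sides of `(a + n) * baileyBeta a m n = ∑ k, degenerateTerm n m k a` vanish at `a = -n`;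
comparing their derivatives there evaluates `baileyBeta (-n) m n`. -/
lemma baileyBeta_neg_self (n m : ℕ) :
    baileyBeta (-(n : ℚ)) m n = (-1) ^ n * harmonicT n (-2 * (m : ℤ)) := by
  have hcont := continuousAt_baileyBeta n m n le_rfl
  have hF : HasDerivAt (fun a => ∑ k ∈ range (n + 1), degenerateTerm n m k a)
      ((-1) ^ n * harmonicT n (-2 * (m : ℤ))) (-(n : ℚ)) := by
    rw [← sum_deriv_degenerateTerm, mul_sum]
    exact HasDerivAt.fun_sum fun k hk =>
      hasDerivAt_degenerateTerm n m k (by simpa [Nat.lt_succ_iff] using hk)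
  have hev : ∀ᶠ a in nhdsWithin (-(n : ℚ)) {-(n : ℚ)}ᶜ,
      (a + n) * baileyBeta a m n = ∑ k ∈ range (n + 1), degenerateTerm n m k a := by
    have hball := mem_nhdsWithin_of_mem_nhds (t := {-(n : ℚ)}ᶜ)
      (Metric.ball_mem_nhds (-(n : ℚ)) one_pos)
    filter_upwards [hball, self_mem_nhdsWithin] with a ha hne
    refine add_mul_baileyBeta n m a fun i hi => hne ?_
    -- `a` would be an integer at distance less than `1` from `-n`
    have hai : a = -(i : ℚ) := by linarith
    rw [Metric.mem_ball, dist_comm, hai] at ha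
    have h1 : |((i : ℤ) - n : ℤ)| < 1 := by
      have : dist (-(n : ℚ)) (-(i : ℚ)) = ((|((i : ℤ) - n : ℤ)| : ℤ) : ℝ) := by
        rw [Rat.dist_eq]; push_cast; congr 1; ring
      rw [this] at ha
      exact_mod_cast ha
    have h2 : (i : ℤ) = n := by have := Int.abs_lt_one_iff.mp h1; omega
    have h3 : (i : ℚ) = n := by exact_mod_cast h2
    simp [hai, h3]
  have hcont' : ContinuousAt (fun a : ℚ => (a + n) * baileyBeta a m n) (-(n : ℚ)) :=
    (continuousAt_id.add continuousAt_const).mul hcont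
  have h0 : ∑ k ∈ range (n + 1), degenerateTerm n m k (-(n : ℚ)) = 0 := by
    have hl := (hF.continuousAt.tendsto.mono_left nhdsWithin_le_nhds).congr'
      (hev.mono fun a h => h.symm)
    have := tendsto_nhds_unique hl (hcont'.tendsto.mono_left nhdsWithin_le_nhds)
    simpa using this
  rw [hasDerivAt_iff_tendsto_slope] at hF
  refine tendsto_nhds_unique (hcont.tendsto.mono_left nhdsWithin_le_nhds) (hF.congr' ?_)
  filter_upwards [hev, self_mem_nhdsWithin] with a ha hne
  have hne' : a + n ≠ 0 := fun h => hne (by simp; linarith)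
  rw [slope_def_field, h0, ← ha, sub_zero, sub_neg_eq_add, mul_div_cancel_left₀ _ hne']

/-! ### Sums over weakly increasing chains -/

/-- The weight of a step `i ≤ j` of a chain, that is, the factor with `i_r = i`, `i_{r+1} = j`. -/
noncomputable def chainWeight (n i j : ℕ) : ℚ :=
  (1 / (1 + (n : ℚ) - (i : ℚ))) *
    ((shiftedFactorial 1 i * shiftedFactorial (-(j : ℚ)) i) /
      (shiftedFactorial (-(n : ℚ)) i * shiftedFactorial (2 + (n : ℚ) - (j : ℚ)) i))

/-- The sum of the products of the weights over all chains `i_1 ≤ ⋯ ≤ i_m ≤ i_{m+1} = N`. The end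
`N` varies independently of the parameter `n` of the weights, so that chains can be split. -/
noncomputable def chainSum (n m N : ℕ) : ℚ :=
  ∑ i ∈ weakChains m N, ∏ r : Fin m, chainWeight n (i r) (extendChain N i r.succ)

lemma mem_weakChains {m n : ℕ} {i : Fin m → ℕ} :
    i ∈ weakChains m n ↔ (∀ r, i r ≤ n) ∧ ∀ r s, r ≤ s → i r ≤ i s := by
  simp [weakChains]

lemma chainSum_zero (n N : ℕ) : chainSum n 0 N = 1 := by
  have h : weakChains 0 N = univ := by
    ext i
    simp only [mem_weakChains, mem_univ, iff_true]
    exact ⟨fun r => r.elim0, fun r => r.elim0⟩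
  simp [chainSum, h]

lemma snoc_mem_weakChains {m N j : ℕ} {i : Fin m → ℕ} (hj : j ≤ N) (hi : i ∈ weakChains m j) :
    (Fin.snoc (α := fun _ => ℕ) i j : Fin (m + 1) → ℕ) ∈ weakChains (m + 1) N := by
  rw [mem_weakChains] at hi ⊢
  refine ⟨fun r => ?_, fun r s => ?_⟩
  · refine Fin.lastCases ?_ (fun r => ?_) r
    · simpa using hj
    · simpa using (hi.1 r).trans hj
  · refine Fin.lastCases ?_ (fun s => ?_) s
    · refine Fin.lastCases ?_ (fun r => ?_) r
      · simp
      · intro _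
        simpa using hi.1 r
    · refine Fin.lastCases ?_ (fun r => ?_) r
      · intro h
        exact absurd h (by simp)
      · intro h
        simpa using hi.2 r s (by simpa using h)

lemma init_mem_weakChains {m N : ℕ} {i : Fin (m + 1) → ℕ} (hi : i ∈ weakChains (m + 1) N) :
    (Fin.init i : Fin m → ℕ) ∈ weakChains m (i (Fin.last m)) := by
  rw [mem_weakChains] at hi ⊢
  exact ⟨fun r => hi.2 _ _ (Fin.le_last _), fun r s h => hi.2 _ _ (by simpa using h)⟩

lemma prod_chainWeight_snoc (n m N j : ℕ) (i : Fin m → ℕ) :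
    ∏ r : Fin (m + 1), chainWeight n ((Fin.snoc (α := fun _ => ℕ) i j : Fin (m + 1) → ℕ) r)
        (extendChain N (Fin.snoc (α := fun _ => ℕ) i j : Fin (m + 1) → ℕ) r.succ) =
      chainWeight n j N * ∏ r : Fin m, chainWeight n (i r) (extendChain j i r.succ) := by
  rw [Fin.prod_univ_castSucc, mul_comm]
  congr 1
  · simp [extendChain, Fin.succ_last]
  · refine prod_congr rfl fun r _ => ?_
    simp only [extendChain, Fin.succ_castSucc, Fin.snoc_castSucc]

/-- Splitting off the largest entry of a chain. -/
lemma chainSum_succ (n m N : ℕ) :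
    chainSum n (m + 1) N = ∑ j ∈ range (N + 1), chainWeight n j N * chainSum n m j := by
  simp_rw [chainSum, mul_sum]
  rw [sum_sigma']
  refine (sum_bij'
    (fun p _ => (Fin.snoc (α := fun _ => ℕ) p.2 p.1 : Fin (m + 1) → ℕ))
    (fun i _ => (⟨i (Fin.last m), Fin.init i⟩ : (_ : ℕ) × (Fin m → ℕ))) ?_ ?_ ?_ ?_ ?_).symm
  · rintro ⟨j, i⟩ h
    simp only [mem_sigma, mem_range, Nat.lt_succ_iff] at h
    exact snoc_mem_weakChains h.1 h.2
  · intro i hi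
    simp only [mem_sigma, mem_range, Nat.lt_succ_iff]
    exact ⟨(mem_weakChains.mp hi).1 _, init_mem_weakChains hi⟩
  · rintro ⟨j, i⟩ _
    simp
  · intro i _
    simp
  · rintro ⟨j, i⟩ _
    exact (prod_chainWeight_snoc n m N j i).symm

/-- At `a = -n` the recursion defining `baileyBeta` turns into that of `chainSum`. -/
lemma baileyBeta_neg (n m N : ℕ) (hN : N ≤ n) :
    baileyBeta (-(n : ℚ)) m N =
      shiftedFactorial (-(n : ℚ) - 1) N / (N.factorial : ℚ) * (1 + n) ^ m * chainSum n m N := by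
  induction m generalizing N with
  | zero => simp [baileyBeta, chainSum_zero]
  | succ m ih =>
    rw [baileyBeta, chainSum_succ, mul_sum]
    refine sum_congr rfl fun j hj => ?_
    have hj : j ≤ N := by simpa [Nat.lt_succ_iff] using hj
    rw [ih j (hj.trans hN), chainWeight, shiftedFactorial_one_left,
      shiftedFactorial_reflect (-(n : ℚ) - 1) hj,
      show 1 - (-(n : ℚ) - 1) - N = 2 + n - N by ring]
    have hjn : (j : ℚ) ≤ n := by exact_mod_cast hj.trans hN
    have hNn : (N : ℚ) ≤ n := by exact_mod_cast hN
    have h1 := shiftedFactorial_neg_mul_factorial hj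
    have h2 : shiftedFactorial (-(n : ℚ) - 1) j =
        (1 + n) / (1 + n - j) * shiftedFactorial (-(n : ℚ)) j := by
      have e1 := shiftedFactorial_succ (-(n : ℚ) - 1) j
      rw [shiftedFactorial_succ_left, sub_add_cancel] at e1
      have : (1 : ℚ) + n - j ≠ 0 := by linarith
      field_simp
      linear_combination e1
    have h3 : (j.factorial : ℚ) ≠ 0 := by exact_mod_cast j.factorial_ne_zero
    have h4 : (N.factorial : ℚ) ≠ 0 := by exact_mod_cast N.factorial_ne_zero
    have h5 : ((N - j).factorial : ℚ) ≠ 0 := by exact_mod_cast (N - j).factorial_ne_zero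
    have h6 := shiftedFactorial_neg_ne_zero (hj.trans hN)
    have h7 : shiftedFactorial (2 + (n : ℚ) - N) j ≠ 0 :=
      (shiftedFactorial_pos (by linarith) j).ne'
    have h8 : (1 : ℚ) + n - j ≠ 0 := by linarith
    have hs : ((-1 : ℚ) ^ j) * (-1) ^ j = 1 := by rw [← mul_pow]; simp
    rw [← eq_div_iff h5] at h1
    rw [h1, h2, pow_succ (1 + (n : ℚ))]
    field_simp
    linear_combination
      (-(shiftedFactorial (-(n : ℚ) - 1) (N - j) * chainSum n m j)) * hs

lemma harmonicT_eq_chainSum (n m : ℕ) :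
    harmonicT n (-2 * (m : ℤ)) = (1 + (n : ℚ)) ^ (m + 1) * chainSum n m n := by
  have h := (baileyBeta_neg_self n m).symm.trans (baileyBeta_neg n m n le_rfl)
  have h1 := shiftedFactorial_neg_mul_factorial (Nat.le_succ n)
  rw [Nat.succ_eq_add_one, Nat.add_sub_cancel_left, Nat.factorial_one, Nat.cast_one, mul_one,
    Nat.factorial_succ] at h1
  push_cast at h1
  have h4 : (n.factorial : ℚ) ≠ 0 := by exact_mod_cast n.factorial_ne_zero
  rw [show -(n : ℚ) - 1 = -(n + 1) by ring, h1] at h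
  have hs : ((-1 : ℚ) ^ n) ≠ 0 := by simp
  refine mul_left_cancel₀ hs (h.trans ?_)
  field_simp
  ring

lemma chainWeight_self (n i : ℕ) (hi : i ≤ n) :
    chainWeight n i n = 1 / (1 + (i : ℚ)) * (1 / (1 + (n : ℚ) - i)) := by
  have h6 := shiftedFactorial_neg_ne_zero hi
  have h : shiftedFactorial 2 i = (1 + i) * shiftedFactorial 1 i := by
    have := shiftedFactorial_succ_left 1 i
    rw [shiftedFactorial_succ] at this
    norm_num at this
    rw [← this, mul_comm]
  have h1 : shiftedFactorial 1 i ≠ 0 := (shiftedFactorial_pos one_pos i).ne'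
  have h2 : (1 : ℚ) + i ≠ 0 := by positivity
  rw [chainWeight, add_sub_cancel_right, h]
  field_simp

/-- The factor `1 / (1 + n - i)` from the next larger entry `i` of the chain is absorbed into the
second shifted factorial of the denominator. -/
lemma one_div_mul_chainWeight (n i j : ℕ) :
    1 / (1 + (n : ℚ) - i) * chainWeight n j i =
      (shiftedFactorial 1 j * shiftedFactorial (-(i : ℚ)) j) /
        (shiftedFactorial (-(n : ℚ)) j * shiftedFactorial (1 + (n : ℚ) - i) (j + 1)) *
        (1 / (1 + (n : ℚ) - j)) := by
  rw [chainWeight, shiftedFactorial_succ_left, show 1 + (n : ℚ) - i + 1 = 2 + n - i by ring]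
  simp only [div_eq_mul_inv, mul_inv]
  ring

theorem mainTheorem5 (n : ℕ) :
    (∀ m : ℕ,
      harmonicT n (-2 * (m : ℤ)) =
        (1 + (n : ℚ)) ^ (m + 1) *
          ∑ i ∈ weakChains m n, ∏ r : Fin m,
            (1 / (1 + (n : ℚ) - (i r : ℚ))) *
              ((shiftedFactorial 1 (i r) *
                  shiftedFactorial (-(extendChain n i r.succ : ℚ)) (i r)) /
                (shiftedFactorial (-(n : ℚ)) (i r) *
                  shiftedFactorial (2 + (n : ℚ) - (extendChain n i r.succ : ℚ)) (i r)))) ∧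
    harmonicT n (-4) =
      (1 + (n : ℚ)) ^ 3 *
        ∑ i ∈ range (n + 1), (1 / (1 + (i : ℚ))) *
          ∑ j ∈ range (i + 1),
            ((shiftedFactorial 1 j * shiftedFactorial (-(i : ℚ)) j) /
              (shiftedFactorial (-(n : ℚ)) j *
                shiftedFactorial (1 + (n : ℚ) - (i : ℚ)) (j + 1))) *
              (1 / (1 + (n : ℚ) - (j : ℚ))) ∧
    harmonicT n (-6) =
      (1 + (n : ℚ)) ^ 4 *
        ∑ i ∈ range (n + 1), (1 / (1 + (i : ℚ))) *
          ∑ j ∈ range (i + 1),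
            ((shiftedFactorial 1 j * shiftedFactorial (-(i : ℚ)) j) /
              (shiftedFactorial (-(n : ℚ)) j *
                shiftedFactorial (1 + (n : ℚ) - (i : ℚ)) (j + 1))) *
            ∑ t ∈ range (j + 1),
              ((shiftedFactorial 1 t * shiftedFactorial (-(j : ℚ)) t) /
                (shiftedFactorial (-(n : ℚ)) t *
                  shiftedFactorial (1 + (n : ℚ) - (j : ℚ)) (t + 1))) *
                (1 / (1 + (n : ℚ) - (t : ℚ))) := by
  refine ⟨harmonicT_eq_chainSum n, ?_, ?_⟩
  · have h := harmonicT_eq_chainSum n 2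
    norm_num at h
    rw [h, chainSum_succ]
    congr 1
    refine sum_congr rfl fun i hi => ?_
    rw [chainWeight_self n i (by simpa [Nat.lt_succ_iff] using hi), mul_assoc, chainSum_succ,
      mul_sum]
    congr 1
    refine sum_congr rfl fun j _ => ?_
    rw [chainSum_zero, mul_one, one_div_mul_chainWeight]
  · have h := harmonicT_eq_chainSum n 3
    norm_num at h
    rw [h, chainSum_succ]
    congr 1
    refine sum_congr rfl fun i hi => ?_
    rw [chainWeight_self n i (by simpa [Nat.lt_succ_iff] using hi), mul_assoc, chainSum_succ,
      mul_sum]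
    congr 1
    refine sum_congr rfl fun j _ => ?_
    rw [← mul_assoc, one_div_mul_chainWeight, mul_assoc, chainSum_succ, mul_sum]
    congr 1
    refine sum_congr rfl fun t _ => ?_
    rw [chainSum_zero, mul_one, one_div_mul_chainWeight]
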